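/- **Theorem 1.3 (Norms of random matrices).** There is a real polynomial $P$ in five variables such that the following holds. Let $p>2$, $\delta>0$, $K,L\ge 0$, let $n,N$ be non-negative integers, and let $X_1,\dots,X_N$ be independent (not necessarily identically distributed) random vectors in $\mathbb{R}^n$ such that, for every $i\le N$, $$\|X_i\|_2\le K\sqrt n\ \text{ almost surely},\qquad \big(\mathbb{E}|\langle X_i,x\rangle|^{q}\big)^{1/q}\le L\ \text{ for all } x\in\mathbb{R}^n \text{ with } \|x\|_2=1,\qquad\text{where } q=4p.$$ Then the $N\times n$ random matrix $A$ with rows $X_1,\dots,X_N$ satisfies, with probability at least $1-\delta$, $$\|A\|_{\ell_2\to\ell_p}:=\sup_{\|x\|_2\le 1}\|Ax\|_p\le C\,\big(n^{1/2}+N^{1/p}\big),\qquad C=P\Big(K,\,L,\,p,\,\frac1\delta,\,\frac1{p-2}\Big).$$ In particular $C$ depends only, and polynomially, on $K$, $L$, $p$, $\delta$ (polynomially in $1/\delta$ as $\delta\to0$ and in $1/(p-2)$ as $p\to2$). -/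

import Mathlib

open MeasureTheory ProbabilityTheory

/-- The norm `‖y‖_p = (∑ᵢ |yᵢ|^p)^(1/p)` of a vector `y ∈ ℝ^N`, for a real exponent `p`. -/
noncomputable def ellNorm {N : ℕ} (p : ℝ) (y : Fin N → ℝ) : ℝ :=
  (∑ i, |y i| ^ p) ^ (1 / p)

/-- The operator norm `‖A‖_{ℓ₂ → ℓ_p}` of an `N × n` real matrix: the supremum of `‖A x‖_p` over
the Euclidean unit ball of `ℝⁿ`. -/
noncomputable def ellTwoToEllNorm {N n : ℕ} (p : ℝ) (A : Matrix (Fin N) (Fin n) ℝ) : ℝ :=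
  sSup ((fun x : EuclideanSpace ℝ (Fin n) => ellNorm p (A.mulVec x.ofLp)) ''
    Metric.closedBall 0 1)

/-- The supremum in `ellTwoToEllNorm` is a genuine one. -/
theorem bddAbove_ellTwoToEllNorm {N n : ℕ} {p : ℝ} (hp : 0 < p) (A : Matrix (Fin N) (Fin n) ℝ) :
    BddAbove ((fun x : EuclideanSpace ℝ (Fin n) => ellNorm p (A.mulVec x.ofLp)) ''
      Metric.closedBall 0 1) := by
  apply ((isCompact_closedBall _ _).image _).bddAbove
  have h : Continuous fun x : EuclideanSpace ℝ (Fin n) => A.mulVec x.ofLp :=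
    Continuous.matrix_mulVec continuous_const (PiLp.continuous_ofLp 2 _)
  refine Continuous.rpow_const (continuous_finsetSum _ fun i _ => ?_)
    fun _ => Or.inr (by positivity)
  exact Continuous.rpow_const ((continuous_apply i).comp h).abs fun _ => Or.inr hp.le

/-- The `N × n` random matrix whose rows are the random vectors `X₁, …, X_N`. -/
def rowMatrix {Ω : Type*} {N n : ℕ} (X : Fin N → Ω → EuclideanSpace ℝ (Fin n)) (ω : Ω) :
    Matrix (Fin N) (Fin n) ℝ :=
  Matrix.of fun i j => X i ω j

/-- The boundedness and moment assumptions with parameters `K`, `L`, `q`: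
`‖X_i‖₂ ≤ K √n` almost surely, and `(𝔼 |⟨X_i, x⟩|^q)^(1/q) ≤ L` for all unit vectors `x`. -/
structure BoundedWithMoments {Ω : Type*} [MeasurableSpace Ω] (μ : Measure Ω) {N n : ℕ}
    (X : Fin N → Ω → EuclideanSpace ℝ (Fin n)) (K L q : ℝ) : Prop where
  bounded : ∀ i, ∀ᵐ ω ∂μ, ‖X i ω‖ ≤ K * √(n : ℝ)
  moment : ∀ i, ∀ x : EuclideanSpace ℝ (Fin n), ‖x‖ = 1 →
    eLpNorm (fun ω => inner ℝ (X i ω) x) (ENNReal.ofReal q) μ ≤ ENNReal.ofReal L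

/-! A net over the unit ball is replaced by compression. If about `2k` of the `X_i` correlate
strongly with one `x`, a perceptron argument replaces `x` by `y = ∑ d_i X_i` with integer `d` and `∑
|d_i| ≤ k` (`exists_nat_combination_le_inner`). At most `k` vectors enter `y`, so `k` of the
correlated ones do not, and these still correlate with `y` (`SpreadAt.card_le_abs_inner_lt`).

For fixed `d`, `y` is independent of those `k` vectors, so Markov's inequality bounds the
probability by `((L/t)^q)^k`. There are at most `(CN/k)^k` choices for each of `d` and the `k`-set,
and with `q = 4p`, `t ~ (N/k)^(1/(2p))` this `q`-th moment bound absorbs both factors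
(`measure_exists_not_spreadAt_le`).

Outside the exceptional event, uniformly in `x`, the `j`-th largest `|⟨X_i, x⟩|` is `O(K√n/√j + τ
(N/j)^(1/(2p)))`. The `ℓ_p` norm of this is `O(√n + N^(1/p))`; `p > 2` makes the first term
summable. -/

/-! ### Compression of a direction -/

/-- Perceptron-type compression: vectors of norm at most `R` having inner product at least `B` with
some vector of the unit ball also have a large inner product with a short integer combination of
themselves. -/
theorem exists_nat_combination_le_inner {V ι : Type*} [NormedAddCommGroup V]
    [InnerProductSpace ℝ V] [DecidableEq ι] (E : Finset ι) (v : ι → V) {x : V} (hx : ‖x‖ ≤ 1)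
    {B R : ℝ} (hB : 0 < B) (hv : ∀ i ∈ E, ‖v i‖ ≤ R) (hvx : ∀ i ∈ E, B ≤ inner ℝ (v i) x) :
    ∃ c : ι → ℕ, (∑ i ∈ E, (c i : ℝ)) * B ^ 2 ≤ 3 * R ^ 2 ∧
      (∀ i ∈ E, R ^ 2 ≤ inner ℝ (v i) (∑ j ∈ E, (c j : ℝ) • v j)) ∧
      ∀ i ∈ E, B * ‖∑ j ∈ E, (c j : ℝ) • v j‖ ≤
        3 * inner ℝ (v i) (∑ j ∈ E, (c j : ℝ) • v j) := by
  have lower : ∀ c : ι → ℕ, (∑ i ∈ E, (c i : ℝ)) * B ≤ ‖∑ j ∈ E, (c j : ℝ) • v j‖ := by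
    intro c
    calc (∑ i ∈ E, (c i : ℝ)) * B ≤ inner ℝ (∑ j ∈ E, (c j : ℝ) • v j) x := by
          rw [sum_inner, Finset.sum_mul]
          refine Finset.sum_le_sum fun i hi => ?_
          rw [real_inner_smul_left]
          exact mul_le_mul_of_nonneg_left (hvx i hi) (Nat.cast_nonneg _)
      _ ≤ ‖∑ j ∈ E, (c j : ℝ) • v j‖ * ‖x‖ := real_inner_le_norm _ _
      _ ≤ _ := mul_le_of_le_one_right (norm_nonneg _) hx
  have short : ∀ c : ι → ℕ, ‖∑ j ∈ E, (c j : ℝ) • v j‖ ^ 2 ≤ 3 * R ^ 2 * ∑ i ∈ E, (c i : ℝ) →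
      (∑ i ∈ E, (c i : ℝ)) * B ^ 2 ≤ 3 * R ^ 2 := by
    intro c hc
    have h0 : 0 ≤ ∑ i ∈ E, (c i : ℝ) := Finset.sum_nonneg fun _ _ => Nat.cast_nonneg _
    rcases h0.eq_or_lt with h | h
    · rw [← h]; nlinarith [sq_nonneg R]
    · have h1 : ((∑ i ∈ E, (c i : ℝ)) * B) ^ 2 ≤ 3 * R ^ 2 * ∑ i ∈ E, (c i : ℝ) :=
        (pow_le_pow_left₀ (by positivity) (lower c) 2).trans hc
      nlinarith
  by_contra! hcon
  -- Perceptron update: while some `⟨v i, y⟩ < R²`, add `v i` to `y`. This raises `‖y‖²` by at most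
  -- `2R² + R²`, while `T` updates force `‖y‖ ≥ T B`, so `T ≤ 3R²/B²`.
  have step : ∀ T : ℕ, ∃ c : ι → ℕ, ∑ i ∈ E, (c i : ℝ) = T ∧
      ‖∑ j ∈ E, (c j : ℝ) • v j‖ ^ 2 ≤ 3 * R ^ 2 * ∑ i ∈ E, (c i : ℝ) := by
    intro T
    induction T with
    | zero => exact ⟨0, by simp, by simp⟩
    | succ T ih =>
      obtain ⟨c, hcT, hc⟩ := ih
      have hs := short c hc
      obtain ⟨i, hi, hlt⟩ : ∃ i ∈ E, inner ℝ (v i) (∑ j ∈ E, (c j : ℝ) • v j) < R ^ 2 := by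
        by_contra! hall
        obtain ⟨i, hi, hlt⟩ := hcon c hs hall
        have h1 := hall i hi
        -- Together the two bounds give `B‖y‖ ≤ 3R²`, so the last required inequality follows once
        -- every `⟨v i, y⟩ ≥ R²`.
        have h2 : (B * ‖∑ j ∈ E, (c j : ℝ) • v j‖) ^ 2 ≤ (3 * R ^ 2) ^ 2 := by
          rw [mul_pow]
          nlinarith [mul_le_mul_of_nonneg_left hc (sq_nonneg B),
            mul_le_mul_of_nonneg_left hs (by positivity : 0 ≤ 3 * R ^ 2)]
        have h3 := abs_le_of_sq_le_sq h2 (by positivity)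
        linarith [le_abs_self (B * ‖∑ j ∈ E, (c j : ℝ) • v j‖)]
      have hsum : ∑ j ∈ E, ((c + Pi.single i 1 : ι → ℕ) j : ℝ) = (∑ j ∈ E, (c j : ℝ)) + 1 := by
        simp only [Pi.add_apply, Nat.cast_add, Finset.sum_add_distrib, add_right_inj]
        rw [Finset.sum_eq_single_of_mem i hi] <;> simp +contextual
      have hvec : ∑ j ∈ E, ((c + Pi.single i 1 : ι → ℕ) j : ℝ) • v j =
          (∑ j ∈ E, (c j : ℝ) • v j) + v i := by
        simp only [Pi.add_apply, Nat.cast_add, add_smul, Finset.sum_add_distrib, add_right_inj]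
        rw [Finset.sum_eq_single_of_mem i hi] <;> simp +contextual
      refine ⟨c + Pi.single i 1, ?_, ?_⟩
      · rw [hsum, hcT]; push_cast; rfl
      · rw [hsum, hvec, norm_add_sq_real, real_inner_comm]
        have := pow_le_pow_left₀ (norm_nonneg _) (hv i hi) 2
        nlinarith
  obtain ⟨T, hT⟩ := exists_nat_gt (3 * R ^ 2 / B ^ 2)
  obtain ⟨c, hcT, hc⟩ := step T
  have := short c hc
  rw [hcT] at this
  rw [div_lt_iff₀ (by positivity)] at hT
  linarith

/-! ### Counting coefficient vectors and index sets -/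

/-- The integer points of the `ℓ₁` ball of radius `k`. -/
noncomputable def intEllOneBall (ι : Type*) [Fintype ι] [DecidableEq ι] (k : ℕ) :
    Finset (ι → ℤ) :=
  (Fintype.piFinset fun _ => Finset.Icc (-(k : ℤ)) k).filter fun d => ∑ i, (d i).natAbs ≤ k

theorem mem_intEllOneBall {ι : Type*} [Fintype ι] [DecidableEq ι] {k : ℕ} {d : ι → ℤ} :
    d ∈ intEllOneBall ι k ↔ ∑ i, (d i).natAbs ≤ k := by
  simp only [intEllOneBall, Finset.mem_filter, Fintype.mem_piFinset, Finset.mem_Icc,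
    and_iff_right_iff_imp]
  intro h i
  have := (Finset.single_le_sum (f := fun i => (d i).natAbs) (fun _ _ => Nat.zero_le _)
    (Finset.mem_univ i)).trans h
  omega

theorem sum_Icc_pow_natAbs_le {z : ℝ} (hz : 0 < z) (hz' : z ≤ 1 / 2) (k : ℕ) :
    ∑ a ∈ Finset.Icc (-(k : ℤ)) k, z ^ a.natAbs ≤ 1 + 4 * z := by
  have h : ∑ a ∈ Finset.Icc (-(k : ℤ)) k, z ^ a.natAbs =
      1 + 2 * ∑ j ∈ Finset.range k, z ^ (j + 1) := by
    induction k with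
    | zero => simp
    | succ k ih =>
      have : Finset.Icc (-((k + 1 : ℕ) : ℤ)) (k + 1 : ℕ) =
          insert (-((k : ℤ) + 1)) (insert ((k : ℤ) + 1) (Finset.Icc (-(k : ℤ)) k)) := by
        ext a; simp only [Finset.mem_Icc, Finset.mem_insert]; push_cast; omega
      rw [this, Finset.sum_insert, Finset.sum_insert, ih, Finset.sum_range_succ]
      · have h1 : (-((k : ℤ) + 1)).natAbs = k + 1 := by omega
        have h2 : ((k : ℤ) + 1).natAbs = k + 1 := by omega
        rw [h1, h2]; ring
      · simp
      · simp only [Finset.mem_Icc, Finset.mem_insert]; omega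
  have h2 : ∑ j ∈ Finset.range k, z ^ (j + 1) ≤ 2 * z := by
    have hg : ∑ j ∈ Finset.range k, z ^ j ≤ (1 - z)⁻¹ := by
      rw [← tsum_geometric_of_lt_one hz.le (by linarith)]
      exact (summable_geometric_of_lt_one hz.le (by linarith)).sum_le_tsum _
        fun _ _ => by positivity
    have hi : (1 - z)⁻¹ ≤ 2 := by
      rw [inv_le_comm₀ (by linarith) (by norm_num)]; linarith
    simp only [pow_succ, ← Finset.sum_mul]
    nlinarith
  linarith

/-- Generating function bound: weight `d` by `z ^ ∑ |d i|`, which is at least `z ^ k` on the ball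
and factors over coordinates. The choice `z = k/(2N)` makes the total at most `e^(2k) ≤ 9^k`. -/
theorem card_intEllOneBall_le {N k : ℕ} (hk : 1 ≤ k) (hkN : k ≤ N) :
    ((intEllOneBall (Fin N) k).card : ℝ) ≤ (18 * (N / k)) ^ k := by
  have hk0 : (0 : ℝ) < k := by exact_mod_cast hk
  have hkN' : (k : ℝ) ≤ N := by exact_mod_cast hkN
  have hN0 : (0 : ℝ) < N := hk0.trans_le hkN'
  set z : ℝ := k / (2 * N) with hz
  have hz0 : 0 < z := by positivity
  have hz1 : z ≤ 1 / 2 := by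
    rw [hz, div_le_div_iff₀ (by positivity) (by norm_num)]; linarith
  have h1 : ((intEllOneBall (Fin N) k).card : ℝ) * z ^ k ≤ (1 + 4 * z) ^ N := by
    calc ((intEllOneBall (Fin N) k).card : ℝ) * z ^ k
        = ∑ d ∈ intEllOneBall (Fin N) k, z ^ k := by simp
      _ ≤ ∑ d ∈ intEllOneBall (Fin N) k, ∏ i, z ^ (d i).natAbs := by
          refine Finset.sum_le_sum fun d hd => ?_
          rw [Finset.prod_pow_eq_pow_sum]
          exact pow_le_pow_of_le_one hz0.le (by linarith) (mem_intEllOneBall.1 hd)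
      _ ≤ ∑ d ∈ Fintype.piFinset fun _ : Fin N => Finset.Icc (-(k : ℤ)) k,
            ∏ i, z ^ (d i).natAbs :=
          Finset.sum_le_sum_of_subset_of_nonneg (Finset.filter_subset _ _)
            fun _ _ _ => by positivity
      _ = (∑ a ∈ Finset.Icc (-(k : ℤ)) k, z ^ a.natAbs) ^ N := by
          rw [← Finset.prod_univ_sum (fun _ => Finset.Icc (-(k : ℤ)) k)
            (fun _ a => z ^ a.natAbs)]
          simp
      _ ≤ (1 + 4 * z) ^ N :=
          pow_le_pow_left₀ (Finset.sum_nonneg fun _ _ => by positivity)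
            (sum_Icc_pow_natAbs_le hz0 hz1 k) N
  have h2 : (1 + 4 * z) ^ N ≤ 9 ^ k := by
    calc (1 + 4 * z) ^ N ≤ (Real.exp (4 * z)) ^ N :=
          pow_le_pow_left₀ (by positivity) (by linarith [Real.add_one_le_exp (4 * z)]) N
      _ = (Real.exp 1 ^ 2) ^ k := by
          rw [← Real.exp_nat_mul, ← Real.exp_nat_mul, ← Real.exp_nat_mul]
          congr 1
          rw [hz]; push_cast; field_simp; norm_num
      _ ≤ 9 ^ k := by
          have := Real.exp_one_lt_d9
          have h0 := Real.exp_pos 1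
          exact pow_le_pow_left₀ (by positivity) (by nlinarith) k
  calc ((intEllOneBall (Fin N) k).card : ℝ) ≤ 9 ^ k / z ^ k := by
        rw [le_div_iff₀ (by positivity)]; exact h1.trans h2
    _ = (18 * (N / k)) ^ k := by
        rw [← div_pow, hz]; congr 1; field_simp; norm_num

theorem choose_le_three_mul_div_pow {N k : ℕ} (hk : 1 ≤ k) :
    (N.choose k : ℝ) ≤ (3 * (N / k)) ^ k := by
  have hk0 : (0 : ℝ) < k := by exact_mod_cast hk
  have h1 : (k : ℝ) ^ k / k.factorial ≤ 3 ^ k := by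
    calc (k : ℝ) ^ k / k.factorial ≤ Real.exp k := Real.pow_div_factorial_le_exp _ hk0.le k
      _ = Real.exp 1 ^ k := by rw [← Real.exp_nat_mul, mul_one]
      _ ≤ 3 ^ k := pow_le_pow_left₀ (Real.exp_pos 1).le
        (by linarith [Real.exp_one_lt_d9]) k
  calc (N.choose k : ℝ) ≤ N ^ k / k.factorial := Nat.choose_le_pow_div k N
    _ = (k : ℝ) ^ k / k.factorial * (N / k) ^ k := by
        rw [div_pow]; field_simp
    _ ≤ 3 ^ k * (N / k) ^ k := by gcongr
    _ = _ := (mul_pow _ _ _).symm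

/-! ### From spreading to few large inner products -/

/-- The vectors `a i` are spread at level `k` with parameter `t` if no nonzero combination with
integer coefficients in the `ℓ₁` ball of radius `k` has a large inner product with `k` of the
vectors not involved in it. -/
def SpreadAt {V : Type*} [NormedAddCommGroup V] [InnerProductSpace ℝ V] {N : ℕ} (k : ℕ) (t : ℝ)
    (a : Fin N → V) : Prop :=
  ∀ d ∈ intEllOneBall (Fin N) k, ∀ F ∈ Finset.powersetCard k (Finset.univ : Finset (Fin N)),
    (∀ i ∈ F, d i = 0) → ∑ i, (d i : ℝ) • a i ≠ 0 →
      ∃ i ∈ F, |inner ℝ (a i) (∑ j, (d j : ℝ) • a j)| < t * ‖∑ j, (d j : ℝ) • a j‖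

theorem SpreadAt.card_le_abs_inner_lt {V : Type*} [NormedAddCommGroup V] [InnerProductSpace ℝ V]
    {N k : ℕ} {t : ℝ} {a : Fin N → V} (h : SpreadAt k t a) (hk : 1 ≤ k) {R B : ℝ}
    (ha : ∀ i, ‖a i‖ ≤ R) {x : V} (hx : ‖x‖ ≤ 1) (hB : 0 < B) (hRB : 3 * R ^ 2 ≤ k * B ^ 2)
    (htB : 3 * t ≤ B) :
    (Finset.univ.filter fun i => B ≤ |inner ℝ (a i) x|).card < 2 * k := by
  by_contra! hcard
  set E := Finset.univ.filter fun i => B ≤ |inner ℝ (a i) x| with hE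
  -- Flipping signs makes all correlations with `x` positive; the signs are then absorbed into the
  -- integer coefficients.
  let s : Fin N → ℤ := fun i => if 0 ≤ inner ℝ (a i) x then 1 else -1
  have hs : ∀ i, |(s i : ℝ)| = 1 := fun i => by simp only [s]; split_ifs <;> simp
  have hsx : ∀ i ∈ E, B ≤ inner ℝ ((s i : ℝ) • a i) x := by
    intro i hi
    have hi' : B ≤ |inner ℝ (a i) x| := (Finset.mem_filter.1 hi).2
    rw [real_inner_smul_left]
    simp only [s]
    split_ifs with h0
    · simpa [abs_of_nonneg h0] using hi'
    · simpa [abs_of_neg (not_le.1 h0)] using hi'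
  obtain ⟨c, hc, hcR, hcB⟩ := exists_nat_combination_le_inner E (fun i => (s i : ℝ) • a i) hx hB
    (R := R) (fun i _ => by rw [norm_smul, Real.norm_eq_abs, hs, one_mul]; exact ha i) hsx
  have hck : ∑ i ∈ E, c i ≤ k := by
    have : (∑ i ∈ E, (c i : ℝ)) ≤ k :=
      le_of_mul_le_mul_right (hc.trans hRB) (by positivity)
    exact_mod_cast this
  let d : Fin N → ℤ := fun i => if i ∈ E then s i * c i else 0
  have hd : d ∈ intEllOneBall (Fin N) k := by
    rw [mem_intEllOneBall]
    refine le_trans (le_of_eq ?_) hck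
    rw [← Finset.sum_subset (Finset.subset_univ E)]
    · refine Finset.sum_congr rfl fun i hi => ?_
      simp only [d, if_pos hi, s, Int.natAbs_mul]
      split_ifs <;> simp
    · intro i _ hi
      simp [d, hi]
  have hy : ∑ i, (d i : ℝ) • a i = ∑ j ∈ E, (c j : ℝ) • (s j : ℝ) • a j := by
    rw [← Finset.sum_subset (Finset.subset_univ E)]
    · refine Finset.sum_congr rfl fun i hi => ?_
      simp only [d, if_pos hi]
      rw [smul_smul]; push_cast; rw [mul_comm]
    · intro i _ hi
      simp [d, hi]
  -- Integrality: each nonzero coefficient is at least 1, so at most `k` of the at least `2k`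
  -- indices are used.
  have hsupp : (E.filter fun i => c i ≠ 0).card ≤ k := by
    refine le_trans ?_ hck
    rw [Finset.card_eq_sum_ones, Finset.sum_filter]
    refine Finset.sum_le_sum fun i _ => ?_
    split_ifs <;> omega
  have hrest : k ≤ (E.filter fun i => c i = 0).card := by
    have := Finset.card_filter_add_card_filter_not (s := E) (fun i => c i = 0)
    simp only [ne_eq] at hsupp
    omega
  obtain ⟨F, hF, hFk⟩ := Finset.exists_subset_card_eq hrest
  have hFE : ∀ i ∈ F, i ∈ E ∧ c i = 0 := fun i hi => Finset.mem_filter.1 (hF hi)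
  obtain ⟨i₀, hi₀⟩ : F.Nonempty := Finset.card_pos.1 (by omega)
  have hR : 0 < R := by
    have h1 := hsx i₀ (hFE i₀ hi₀).1
    have h2 := real_inner_le_norm ((s i₀ : ℝ) • a i₀) x
    rw [norm_smul, Real.norm_eq_abs, hs, one_mul] at h2
    have h3 := mul_le_of_le_one_right (norm_nonneg (a i₀)) hx
    linarith [ha i₀]
  obtain ⟨i, hi, hlt⟩ := h d hd F (Finset.mem_powersetCard.2 ⟨Finset.subset_univ _, hFk⟩)
    (fun i hi => by simp [d, (hFE i hi).2]) (by
      rw [hy]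
      intro h0
      have := hcR i₀ (hFE i₀ hi₀).1
      rw [h0, inner_zero_right] at this
      nlinarith)
  rw [hy] at hlt
  have h1 := hcB i (hFE i hi).1
  set y := ∑ j ∈ E, (c j : ℝ) • (s j : ℝ) • a j
  have h2 : inner ℝ ((s i : ℝ) • a i) y ≤ |inner ℝ (a i) y| := by
    rw [real_inner_smul_left]
    refine (le_abs_self _).trans ?_
    rw [abs_mul, hs, one_mul]
  have h3 := mul_le_mul_of_nonneg_right htB (norm_nonneg y)
  linarith

/-! ### Probability that spreading fails -/

/-- Fubini: with `Y = y` frozen, the events for `i ∈ F` are independent and each reduces to the unit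
vector `y/‖y‖`. Requiring `Y ω ≠ 0` excludes the case where the inequalities are trivial. -/
theorem measure_forall_mul_norm_le_abs_inner_le {Ω V : Type*} [MeasurableSpace Ω]
    {μ : Measure Ω} [IsProbabilityMeasure μ] [NormedAddCommGroup V] [InnerProductSpace ℝ V]
    [MeasurableSpace V] [BorelSpace V] [SecondCountableTopology V]
    {N : ℕ} {X : Fin N → Ω → V} (hX : ∀ i, Measurable (X i)) (hind : iIndepFun X μ)
    {t : ℝ} {ρ : ENNReal}
    (hρ : ∀ i, ∀ u : V, ‖u‖ = 1 → μ {ω | t ≤ |inner ℝ (X i ω) u|} ≤ ρ)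
    (F : Finset (Fin N)) {Y : Ω → V} (hY : Measurable Y)
    (hYF : IndepFun Y (fun ω (i : F) => X i ω) μ) :
    μ {ω | Y ω ≠ 0 ∧ ∀ i ∈ F, t * ‖Y ω‖ ≤ |inner ℝ (X i ω) (Y ω)|} ≤ ρ ^ F.card := by
  have hZ : Measurable fun ω (i : F) => X i ω := measurable_pi_lambda _ fun i => hX i
  have hmap := (indepFun_iff_map_prod_eq_prod_map_map hY.aemeasurable hZ.aemeasurable).1 hYF
  let S : Set (V × (F → V)) :=
    {z | z.1 ≠ 0} ∩ ⋂ i : F, {z | t * ‖z.1‖ ≤ |inner ℝ (z.2 i) z.1|}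
  have hS : MeasurableSet S := by
    refine MeasurableSet.inter ?_ (MeasurableSet.iInter fun i => measurableSet_le ?_ ?_)
    · exact (measurableSet_singleton (0 : V)).compl.preimage measurable_fst
    · exact measurable_fst.norm.const_mul t
    · exact (((measurable_pi_apply (X := fun _ : F => V) i).comp measurable_snd).inner
        measurable_fst).abs
  have hset : {ω | Y ω ≠ 0 ∧ ∀ i ∈ F, t * ‖Y ω‖ ≤ |inner ℝ (X i ω) (Y ω)|} =
      (fun ω => (Y ω, fun i : F => X i ω)) ⁻¹' S := by
    ext ω; simp [S]
  rw [hset, ← Measure.map_apply (hY.prodMk hZ) hS, hmap, Measure.prod_apply hS]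
  have : IsProbabilityMeasure (μ.map Y) := Measure.isProbabilityMeasure_map hY.aemeasurable
  calc ∫⁻ y, (μ.map fun ω (i : F) => X i ω) (Prod.mk y ⁻¹' S) ∂(μ.map Y)
      ≤ ∫⁻ _, ρ ^ F.card ∂(μ.map Y) := by
        refine lintegral_mono fun y => ?_
        rw [Measure.map_apply hZ (measurable_prodMk_left hS)]
        by_cases hy : y = 0
        · simp [S, hy]
        have hpre : (fun ω (i : F) => X i ω) ⁻¹' (Prod.mk y ⁻¹' S) =
            ⋂ i ∈ F, X i ⁻¹' {v | t * ‖y‖ ≤ |inner ℝ v y|} := by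
          ext ω; simp [S, hy]
        rw [hpre, hind.measure_inter_preimage_eq_mul]
        · refine Finset.prod_le_pow_card _ _ _ fun i _ => ?_
          have hy' : 0 < ‖y‖ := norm_pos_iff.2 hy
          refine le_trans (measure_mono fun ω hω => ?_) (hρ i (‖y‖⁻¹ • y) (by
            rw [norm_smul, norm_inv, norm_norm, inv_mul_cancel₀ hy'.ne']))
          simp only [Set.mem_preimage, Set.mem_ofPred_eq] at hω ⊢
          rw [real_inner_smul_right, abs_mul, abs_of_pos (inv_pos.2 hy'), inv_mul_eq_div,
            le_div_iff₀ hy']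
          exact hω
        · intro i _
          exact measurableSet_le measurable_const (measurable_id.inner measurable_const).abs
    _ = ρ ^ F.card := by simp

theorem measure_not_spreadAt_le {Ω V : Type*} [MeasurableSpace Ω]
    {μ : Measure Ω} [IsProbabilityMeasure μ] [NormedAddCommGroup V] [InnerProductSpace ℝ V]
    [MeasurableSpace V] [BorelSpace V] [SecondCountableTopology V]
    {N : ℕ} {X : Fin N → Ω → V} (hX : ∀ i, Measurable (X i)) (hind : iIndepFun X μ)
    {t r : ℝ} (hr : 0 ≤ r) (hρ : ∀ i, ∀ u : V, ‖u‖ = 1 →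
      μ {ω | t ≤ |inner ℝ (X i ω) u|} ≤ ENNReal.ofReal r)
    {k : ℕ} (hk : 1 ≤ k) (hkN : k ≤ N) :
    μ {ω | ¬ SpreadAt k t fun i => X i ω} ≤
      ENNReal.ofReal ((54 * ((N : ℝ) / k) ^ 2 * r) ^ k) := by
  classical
  -- Summing only over `Fᶜ` makes independence from the vectors in `F` manifest; nothing is lost,
  -- since the relevant `d` vanish on `F`.
  let Y : (Fin N → ℤ) → Finset (Fin N) → Ω → V := fun d F ω => ∑ i ∈ Fᶜ, (d i : ℝ) • X i ω
  have hY : ∀ d F, Measurable (Y d F) := fun d F =>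
    Finset.measurable_sum _ fun i _ => (hX i).const_smul _
  have hsub : {ω | ¬ SpreadAt k t fun i => X i ω} ⊆
      ⋃ d ∈ intEllOneBall (Fin N) k,
        ⋃ F ∈ Finset.powersetCard k (Finset.univ : Finset (Fin N)),
          {ω | Y d F ω ≠ 0 ∧ ∀ i ∈ F, t * ‖Y d F ω‖ ≤ |inner ℝ (X i ω) (Y d F ω)|} := by
    intro ω hω
    simp only [SpreadAt, Set.mem_ofPred_eq] at hω
    push Not at hω
    obtain ⟨d, hd, F, hF, hdF, h0, hle⟩ := hω
    have hYeq : Y d F ω = ∑ i, (d i : ℝ) • X i ω := by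
      refine Finset.sum_subset (Finset.subset_univ _) fun i _ hi => ?_
      rw [hdF i (by simpa using hi)]; simp
    simp only [Set.mem_iUnion]
    exact ⟨d, hd, F, hF, by rw [Set.mem_ofPred_eq, hYeq]; exact ⟨h0, hle⟩⟩
  have hone : ∀ d, ∀ F ∈ Finset.powersetCard k (Finset.univ : Finset (Fin N)),
      μ {ω | Y d F ω ≠ 0 ∧ ∀ i ∈ F, t * ‖Y d F ω‖ ≤ |inner ℝ (X i ω) (Y d F ω)|} ≤
        ENNReal.ofReal r ^ k := by
    intro d F hF
    rw [← (Finset.mem_powersetCard.1 hF).2]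
    refine measure_forall_mul_norm_le_abs_inner_le hX hind hρ F (hY d F) ?_
    have hi := (hind.indepFun_finset Fᶜ F disjoint_compl_left hX).comp
      (φ := fun z : (Fᶜ : Finset (Fin N)) → V => ∑ i, (d i.1 : ℝ) • z i) (ψ := id)
      (Finset.measurable_sum _ fun i _ => (measurable_pi_apply i).const_smul _) measurable_id
    refine (?_ : Y d F = _) ▸ hi
    ext1 ω
    simp only [Y, Function.comp]
    exact (Finset.sum_coe_sort Fᶜ fun i => (d i : ℝ) • X i ω).symm
  calc μ {ω | ¬ SpreadAt k t fun i => X i ω}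
      ≤ ∑ d ∈ intEllOneBall (Fin N) k,
          ∑ F ∈ Finset.powersetCard k (Finset.univ : Finset (Fin N)), ENNReal.ofReal r ^ k :=
        (measure_mono hsub).trans <| (measure_biUnion_finset_le _ _).trans <|
          Finset.sum_le_sum fun d _ => (measure_biUnion_finset_le _ _).trans <|
            Finset.sum_le_sum fun F hF => hone d F hF
    _ = ENNReal.ofReal ((intEllOneBall (Fin N) k).card * (N.choose k * r ^ k)) := by
        rw [ENNReal.ofReal_mul (by positivity), ENNReal.ofReal_mul (by positivity),
          ENNReal.ofReal_pow hr]
        simp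
    _ ≤ ENNReal.ofReal ((18 * (N / k)) ^ k * ((3 * (N / k)) ^ k * r ^ k)) := by
        refine ENNReal.ofReal_le_ofReal ?_
        gcongr
        · exact card_intEllOneBall_le hk hkN
        · exact choose_le_three_mul_div_pow hk
    _ = _ := by rw [← mul_pow, ← mul_pow]; congr 2; ring

theorem measure_le_abs_le_of_eLpNorm_le {Ω : Type*} [MeasurableSpace Ω] {μ : Measure Ω}
    {f : Ω → ℝ} (hf : AEStronglyMeasurable f μ) {q L t : ℝ} (hq : 0 < q) (hL : 0 ≤ L) (ht : 0 < t)
    (h : eLpNorm f (ENNReal.ofReal q) μ ≤ ENNReal.ofReal L) :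
    μ {ω | t ≤ |f ω|} ≤ ENNReal.ofReal ((L / t) ^ q) := by
  have h1 := mul_meas_ge_le_pow_eLpNorm' μ (p := ENNReal.ofReal q) (by simpa using hq)
    ENNReal.ofReal_ne_top hf (ENNReal.ofReal t)
  rw [ENNReal.toReal_ofReal hq.le] at h1
  have hset : {ω | ENNReal.ofReal t ≤ ‖f ω‖ₑ} = {ω | t ≤ |f ω|} := by
    ext ω
    simp only [Set.mem_ofPred_eq, Real.enorm_eq_ofReal_abs,
      ENNReal.ofReal_le_ofReal_iff (abs_nonneg _)]
  rw [hset, ENNReal.ofReal_rpow_of_pos ht] at h1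
  have h2 := h1.trans (ENNReal.rpow_le_rpow h hq.le)
  rw [ENNReal.ofReal_rpow_of_nonneg hL hq.le] at h2
  have htq : 0 < t ^ q := Real.rpow_pos_of_pos ht q
  rw [Real.div_rpow hL ht.le, ENNReal.ofReal_div_of_pos htq,
    ENNReal.le_div_iff_mul_le (by simp [htq]) (by simp), mul_comm]
  exact h2

/-! ### Summing the decreasing rearrangement -/

theorem sum_range_rpow_neg_le {s : ℝ} (hs : 1 < s) (N : ℕ) :
    ∑ j ∈ Finset.range N, ((j : ℝ) + 1) ^ (-s) ≤ 1 + 1 / (s - 1) := by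
  have hs1 : 0 < s - 1 := by linarith
  cases N with
  | zero => simp only [Finset.range_zero, Finset.sum_empty]; positivity
  | succ N =>
    rw [Finset.sum_range_succ']
    have hanti : AntitoneOn (fun x : ℝ => x ^ (-s)) (Set.Icc 1 (1 + (N : ℝ))) := by
      intro x hx y hy hxy
      exact Real.rpow_le_rpow_of_nonpos (by linarith [hx.1]) hxy (by linarith)
    have h1 := hanti.sum_le_integral
    rw [integral_rpow (Or.inr ⟨by linarith, by
      rw [Set.uIcc_of_le (by linarith [Nat.cast_nonneg (α := ℝ) N])]
      rintro ⟨h, _⟩; linarith⟩)] at h1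
    have h2 : ((1 + (N : ℝ)) ^ (-s + 1) - 1 ^ (-s + 1)) / (-s + 1) ≤ 1 / (s - 1) := by
      rw [Real.one_rpow, ← neg_div_neg_eq]
      have : 0 ≤ (1 + (N : ℝ)) ^ (-s + 1) := by positivity
      rw [show -(-s + 1) = s - 1 by ring]
      gcongr
      linarith
    have h3 : ∑ j ∈ Finset.range N, (((j + 1 : ℕ) : ℝ) + 1) ^ (-s) =
        ∑ j ∈ Finset.range N, (1 + ((j + 1 : ℕ) : ℝ)) ^ (-s) :=
      Finset.sum_congr rfl fun j _ => by rw [add_comm]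
    rw [h3]
    simp only [Nat.cast_zero, zero_add, Real.one_rpow]
    linarith

theorem sum_range_sqrt_div_le (N : ℕ) :
    ∑ j ∈ Finset.range N, √((N : ℝ) / (j + 1)) ≤ 2 * N := by
  have h : ∀ M : ℕ, ∑ j ∈ Finset.range M, (√((j : ℝ) + 1))⁻¹ ≤ 2 * √M := by
    intro M
    induction M with
    | zero => simp
    | succ M ih =>
      rw [Finset.sum_range_succ]
      push_cast
      have h0 : 0 < √((M : ℝ) + 1) := by positivity
      have h1 := Real.sq_sqrt (by positivity : 0 ≤ (M : ℝ) + 1)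
      have h2 := Real.sq_sqrt (by positivity : 0 ≤ (M : ℝ))
      have h3 : (√((M : ℝ) + 1))⁻¹ ≤ 2 * √((M : ℝ) + 1) - 2 * √M := by
        rw [inv_le_iff_one_le_mul₀ h0]
        nlinarith [sq_nonneg (√((M : ℝ) + 1) - √M)]
      linarith
  have hN := h N
  calc ∑ j ∈ Finset.range N, √((N : ℝ) / (j + 1))
      = √N * ∑ j ∈ Finset.range N, (√((j : ℝ) + 1))⁻¹ := by
        rw [Finset.mul_sum]
        refine Finset.sum_congr rfl fun j _ => ?_
        rw [Real.sqrt_div (by positivity), div_eq_mul_inv]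
    _ ≤ √N * (2 * √N) := by gcongr
    _ = 2 * N := by
        have := Real.mul_self_sqrt (Nat.cast_nonneg (α := ℝ) N)
        linarith

/-- If fewer than `j` of the numbers `a i` reach `b j` for each `j`, then the sum of the `a i ^ p`
is dominated by the sum of the `b j ^ p`. -/
theorem sum_rpow_le_of_card_le {N : ℕ} {a : Fin N → ℝ} (ha : ∀ i, 0 ≤ a i) {b : ℕ → ℝ} {p : ℝ}
    (hp : 0 ≤ p)
    (h : ∀ j, 1 ≤ j → j ≤ N → (Finset.univ.filter fun i => b j ≤ a i).card < j) :
    ∑ i, a i ^ p ≤ ∑ j ∈ Finset.range N, b (j + 1) ^ p := by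
  have hmono := Tuple.monotone_sort a
  set σ := Tuple.sort a
  -- The sort is increasing, so position `i` has rank `Fin.rev i + 1` from the top: a value above
  -- the bound is shared by all `N - i` later positions.
  have key : ∀ i : Fin N, a (σ i) ≤ b ((Fin.rev i : ℕ) + 1) := by
    intro i
    by_contra! hlt
    have h1 := h ((Fin.rev i : ℕ) + 1) (by omega) (by omega)
    have h2 : ((Finset.Ici i).map σ.toEmbedding).card ≤
        (Finset.univ.filter fun l => b ((Fin.rev i : ℕ) + 1) ≤ a l).card := by
      refine Finset.card_le_card fun l hl => ?_
      obtain ⟨l', hl', rfl⟩ := Finset.mem_map.1 hl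
      simp only [Finset.mem_filter, Finset.mem_univ, true_and]
      exact hlt.le.trans (hmono (Finset.mem_Ici.1 hl'))
    rw [Finset.card_map, Fin.card_Ici] at h2
    have h3 : (Fin.rev i : ℕ) = N - (i + 1) := Fin.val_rev i
    omega
  calc ∑ i, a i ^ p = ∑ i, a (σ i) ^ p := (Equiv.sum_comp σ fun i => a i ^ p).symm
    _ ≤ ∑ i : Fin N, b ((Fin.rev i : ℕ) + 1) ^ p :=
        Finset.sum_le_sum fun i _ => Real.rpow_le_rpow (ha _) (key i) hp
    _ = ∑ i : Fin N, b ((i : ℕ) + 1) ^ p :=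
        Equiv.sum_comp Fin.revPerm fun i : Fin N => b ((i : ℕ) + 1) ^ p
    _ = _ := Fin.sum_univ_eq_sum_range (fun j => b (j + 1) ^ p) N

theorem rpow_one_div_le_self {x p : ℝ} (hx : 1 ≤ x) (hp : 1 ≤ p) : x ^ (1 / p) ≤ x := by
  calc x ^ (1 / p) ≤ x ^ (1 : ℝ) :=
        Real.rpow_le_rpow_of_exponent_le hx (by rw [div_le_one (by linarith)]; exact hp)
    _ = x := Real.rpow_one x

/-- A bound for the `ℓ_p` norm of a finite sequence with the decay `R / √j + D (N / j)^(1/2p)`. -/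
theorem sum_rpow_decay_le {p R D : ℝ} (hp : 2 < p) (hR : 0 ≤ R) (hD : 0 ≤ D) (N : ℕ) :
    (∑ j ∈ Finset.range N,
      (R / √((j : ℝ) + 1) + D * ((N : ℝ) / (j + 1)) ^ (1 / (2 * p))) ^ p) ^ (1 / p) ≤
      R * (1 + 2 * (1 / (p - 2))) + D * 2 * (N : ℝ) ^ (1 / p) := by
  have hp0 : 0 < p := by linarith
  refine (Real.Lp_add_le_of_nonneg _ (by linarith) (fun _ _ => by positivity)
    fun _ _ => by positivity).trans (add_le_add ?_ ?_)
  · have h1 : ∑ j ∈ Finset.range N, (R / √((j : ℝ) + 1)) ^ p =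
        R ^ p * ∑ j ∈ Finset.range N, ((j : ℝ) + 1) ^ (-(p / 2)) := by
      rw [Finset.mul_sum]
      refine Finset.sum_congr rfl fun j _ => ?_
      rw [Real.div_rpow hR (Real.sqrt_nonneg _), Real.rpow_neg (by positivity),
        Real.sqrt_eq_rpow, ← Real.rpow_mul (by positivity), div_eq_mul_inv]
      congr 3; ring
    have h2 := sum_range_rpow_neg_le (s := p / 2) (by linarith) N
    have h3 : 1 / (p / 2 - 1) = 2 * (1 / (p - 2)) := by
      have : p - 2 ≠ 0 := by linarith
      have : p / 2 - 1 ≠ 0 := by intro h; apply this; linarith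
      field_simp
    rw [h1, Real.mul_rpow (by positivity) (Finset.sum_nonneg fun _ _ => by positivity),
      ← Real.rpow_mul hR, mul_one_div_cancel hp0.ne', Real.rpow_one]
    have h4 : 0 < 1 / (p - 2) := by apply one_div_pos.2; linarith
    refine mul_le_mul_of_nonneg_left ?_ hR
    refine le_trans (Real.rpow_le_rpow (Finset.sum_nonneg fun _ _ => by positivity)
      (h2.trans_eq (by rw [h3])) (by positivity)) ?_
    exact rpow_one_div_le_self (by linarith) (by linarith)
  · have h1 : ∑ j ∈ Finset.range N, (D * ((N : ℝ) / (j + 1)) ^ (1 / (2 * p))) ^ p =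
        D ^ p * ∑ j ∈ Finset.range N, √((N : ℝ) / (j + 1)) := by
      rw [Finset.mul_sum]
      refine Finset.sum_congr rfl fun j _ => ?_
      rw [Real.mul_rpow hD (by positivity), ← Real.rpow_mul (by positivity), Real.sqrt_eq_rpow]
      congr 2; field_simp
    rw [h1, Real.mul_rpow (by positivity) (Finset.sum_nonneg fun _ _ => by positivity),
      ← Real.rpow_mul hD, mul_one_div_cancel hp0.ne', Real.rpow_one, mul_assoc]
    refine mul_le_mul_of_nonneg_left ?_ hD
    refine le_trans (Real.rpow_le_rpow (Finset.sum_nonneg fun _ _ => by positivity)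
      (sum_range_sqrt_div_le N) (by positivity)) ?_
    rw [Real.mul_rpow (by norm_num) (by positivity)]
    gcongr
    exact rpow_one_div_le_self (by norm_num) (by linarith)

theorem ellNorm_inner_le_of_spreadAt {V : Type*} [NormedAddCommGroup V] [InnerProductSpace ℝ V]
    {N : ℕ} {a : Fin N → V} {p R τ : ℝ} (hp : 2 < p) (hR : 0 ≤ R) (hτ : 0 < τ)
    (ha : ∀ i, ‖a i‖ ≤ R)
    (h : ∀ k : ℕ, 1 ≤ k → k ≤ N → SpreadAt k (τ * ((N : ℝ) / k) ^ (1 / (2 * p))) a)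
    {x : V} (hx : ‖x‖ ≤ 1) :
    ellNorm p (fun i => inner ℝ (a i) x) ≤
      4 * R * (1 + 2 * (1 / (p - 2))) + 18 * τ * (N : ℝ) ^ (1 / p) := by
  have hp0 : 0 < p := by linarith
  let b : ℕ → ℝ := fun j => 4 * R / √(j : ℝ) + 9 * τ * ((N : ℝ) / j) ^ (1 / (2 * p))
  have hcard : ∀ j, 1 ≤ j → j ≤ N →
      (Finset.univ.filter fun i => b j ≤ |inner ℝ (a i) x|).card < j := by
    intro j hj hjN
    have hj0 : (0 : ℝ) < j := by exact_mod_cast hj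
    have hN0 : (0 : ℝ) < N := by exact_mod_cast (by omega : 0 < N)
    have hpow : 0 < ((N : ℝ) / j) ^ (1 / (2 * p)) := by positivity
    have hb : 0 < b j := by positivity
    -- For `j = 1` the level `j / 2` would be 0, so Cauchy–Schwarz is used instead. For `j ≥ 2`, `j
    -- ≤ 3 (j / 2)`; this loss explains the factors 4 and 9 in `b`.
    rcases hj.eq_or_lt with rfl | hj2
    · rw [Nat.lt_one_iff, Finset.card_eq_zero, Finset.filter_eq_empty_iff]
      intro i _
      have h1 := (abs_real_inner_le_norm (a i) x).trans
        (mul_le_of_le_one_right (norm_nonneg (a i)) hx)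
      have h2 : R < b 1 := by
        simp only [b, Nat.cast_one, Real.sqrt_one, div_one] at hpow ⊢
        have := mul_pos hτ hpow
        linarith
      linarith [ha i]
    · set k := j / 2 with hk
      have hk0 : (0 : ℝ) < k := by exact_mod_cast (by omega : 0 < k)
      have hjk : (j : ℝ) ≤ 3 * k := by exact_mod_cast (by omega : j ≤ 3 * k)
      refine lt_of_lt_of_le ((h k (by omega) (by omega)).card_le_abs_inner_lt (by omega) ha hx hb
        ?_ ?_) (by omega : 2 * k ≤ j)
      · have h1 : 4 * R / √(j : ℝ) ≤ b j := le_add_of_nonneg_right (by positivity)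
        have h2 : (4 * R / √(j : ℝ)) ^ 2 ≤ b j ^ 2 := pow_le_pow_left₀ (by positivity) h1 2
        rw [div_pow, Real.sq_sqrt hj0.le, div_le_iff₀ hj0] at h2
        nlinarith [mul_le_mul_of_nonneg_left hjk (sq_nonneg (b j)), sq_nonneg R]
      · have h1 : ((N : ℝ) / k) ^ (1 / (2 * p)) ≤ 3 * ((N : ℝ) / j) ^ (1 / (2 * p)) := by
          calc ((N : ℝ) / k) ^ (1 / (2 * p)) ≤ (3 * ((N : ℝ) / j)) ^ (1 / (2 * p)) := by
                refine Real.rpow_le_rpow (by positivity) ?_ (by positivity)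
                rw [← mul_div_assoc, div_le_div_iff₀ hk0 hj0]
                nlinarith
            _ = 3 ^ (1 / (2 * p)) * ((N : ℝ) / j) ^ (1 / (2 * p)) :=
                Real.mul_rpow (by norm_num) (by positivity)
            _ ≤ _ := by
                gcongr
                exact rpow_one_div_le_self (by norm_num) (by linarith)
        calc 3 * (τ * ((N : ℝ) / k) ^ (1 / (2 * p)))
            ≤ 3 * (τ * (3 * ((N : ℝ) / j) ^ (1 / (2 * p)))) := by gcongr
          _ = 9 * τ * ((N : ℝ) / j) ^ (1 / (2 * p)) := by ring
          _ ≤ b j := le_add_of_nonneg_left (by positivity)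
  have hsum := sum_rpow_le_of_card_le (fun i => abs_nonneg (inner ℝ (a i) x)) hp0.le hcard
  calc ellNorm p (fun i => inner ℝ (a i) x)
      ≤ (∑ j ∈ Finset.range N, b (j + 1) ^ p) ^ (1 / p) :=
        Real.rpow_le_rpow (Finset.sum_nonneg fun _ _ => by positivity) hsum (by positivity)
    _ ≤ 4 * R * (1 + 2 * (1 / (p - 2))) + 9 * τ * 2 * (N : ℝ) ^ (1 / p) := by
        simp only [b, Nat.cast_add, Nat.cast_one]
        exact sum_rpow_decay_le hp (by positivity) (by positivity) N
    _ = _ := by ring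

/-! ### Union over levels and conclusion -/

theorem measure_exists_not_spreadAt_le {Ω V : Type*} [MeasurableSpace Ω]
    {μ : Measure Ω} [IsProbabilityMeasure μ] [NormedAddCommGroup V] [InnerProductSpace ℝ V]
    [MeasurableSpace V] [BorelSpace V] [SecondCountableTopology V]
    {N : ℕ} {X : Fin N → Ω → V} (hX : ∀ i, Measurable (X i)) (hind : iIndepFun X μ)
    {p δ L : ℝ} (hp : 0 < p) (hδ : 0 < δ) (hδ' : δ ≤ 1) (hL : 0 < L)
    (hmom : ∀ i, ∀ x : V, ‖x‖ = 1 →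
      eLpNorm (fun ω => inner ℝ (X i ω) x) (ENNReal.ofReal (4 * p)) μ ≤ ENNReal.ofReal L) :
    μ {ω | ∃ k : ℕ, 1 ≤ k ∧ k ≤ N ∧ ¬ SpreadAt k
      (L * (108 / δ) ^ (1 / (4 * p)) * ((N : ℝ) / k) ^ (1 / (2 * p))) fun i => X i ω} ≤
      ENNReal.ofReal δ := by
  have hone : ∀ k : ℕ, 1 ≤ k → k ≤ N → μ {ω | ¬ SpreadAt k
      (L * (108 / δ) ^ (1 / (4 * p)) * ((N : ℝ) / k) ^ (1 / (2 * p))) fun i => X i ω} ≤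
      ENNReal.ofReal ((δ / 2) ^ k) := by
    intro k hk hkN
    have hk0 : (0 : ℝ) < k := by exact_mod_cast hk
    have hN0 : (0 : ℝ) < N := by exact_mod_cast (by omega : 0 < N)
    set t := L * (108 / δ) ^ (1 / (4 * p)) * ((N : ℝ) / k) ^ (1 / (2 * p)) with ht
    have ht0 : 0 < t := by positivity
    -- The exponent `4p` turns `(N/k)^(1/(2p))` into `(N/k)²`, cancelling the two counting factors;
    -- then `54 · δ/108 = δ/2`.
    have hr : (L / t) ^ (4 * p) = (108 / δ * ((N : ℝ) / k) ^ 2)⁻¹ := by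
      have : L / t = ((108 / δ) ^ (1 / (4 * p)) * ((N : ℝ) / k) ^ (1 / (2 * p)))⁻¹ := by
        rw [ht, mul_assoc]; field_simp
      rw [this, Real.inv_rpow (by positivity), Real.mul_rpow (by positivity) (by positivity),
        ← Real.rpow_mul (by positivity), ← Real.rpow_mul (by positivity),
        one_div_mul_cancel (by positivity), Real.rpow_one,
        show 1 / (2 * p) * (4 * p) = (2 : ℕ) by field_simp; norm_num, Real.rpow_natCast]
    refine (measure_not_spreadAt_le hX hind (r := (L / t) ^ (4 * p)) (by positivity)
      (fun i u hu => ?_) hk hkN).trans (le_of_eq ?_)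
    · exact measure_le_abs_le_of_eLpNorm_le
        ((hX i).inner measurable_const).aestronglyMeasurable (by positivity) hL.le ht0
        (hmom i u hu)
    · rw [hr]; congr 2; field_simp; norm_num
  have hsub : {ω | ∃ k : ℕ, 1 ≤ k ∧ k ≤ N ∧ ¬ SpreadAt k
      (L * (108 / δ) ^ (1 / (4 * p)) * ((N : ℝ) / k) ^ (1 / (2 * p))) fun i => X i ω} ⊆
      ⋃ k ∈ Finset.Icc 1 N, {ω | ¬ SpreadAt k
        (L * (108 / δ) ^ (1 / (4 * p)) * ((N : ℝ) / k) ^ (1 / (2 * p))) fun i => X i ω} := by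
    rintro ω ⟨k, hk, hkN, hω⟩
    simp only [Set.mem_iUnion]
    exact ⟨k, Finset.mem_Icc.2 ⟨hk, hkN⟩, hω⟩
  refine (measure_mono hsub).trans <| (measure_biUnion_finset_le _ _).trans <|
    (Finset.sum_le_sum fun k hk => hone k (Finset.mem_Icc.1 hk).1 (Finset.mem_Icc.1 hk).2).trans ?_
  rw [← ENNReal.ofReal_sum_of_nonneg fun _ _ => by positivity]
  refine ENNReal.ofReal_le_ofReal ?_
  calc ∑ k ∈ Finset.Icc 1 N, (δ / 2) ^ k = ∑ k ∈ Finset.range N, (δ / 2) ^ (k + 1) := by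
        rw [Finset.range_eq_Ico, Finset.sum_Ico_add' (fun k => (δ / 2) ^ k) 0 N 1]
        rfl
    _ = (∑ k ∈ Finset.range N, (δ / 2) ^ k) * (δ / 2) := by simp only [pow_succ, Finset.sum_mul]
    _ ≤ 2 * (δ / 2) := by
        gcongr
        refine ((summable_geometric_of_lt_one (by positivity) (by linarith)).sum_le_tsum _
          fun _ _ => by positivity).trans ?_
        rw [tsum_geometric_of_lt_one (by positivity) (by linarith),
          inv_le_comm₀ (by linarith) (by norm_num)]
        linarith
    _ = δ := by ring

theorem theorem1p3 :
    ∃ P : MvPolynomial (Fin 5) ℝ,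
      ∀ (p δ K L : ℝ), 2 < p → 0 < δ → 0 ≤ K → 0 ≤ L →
      ∀ (n N : ℕ) (Ω : Type*) [MeasurableSpace Ω] (μ : Measure Ω) [IsProbabilityMeasure μ]
        (X : Fin N → Ω → EuclideanSpace ℝ (Fin n)),
        (∀ i, Measurable (X i)) →
        iIndepFun X μ →
        BoundedWithMoments μ X K L (4 * p) →
        1 - δ ≤ μ.real {ω | ellTwoToEllNorm p (rowMatrix X ω) ≤
          MvPolynomial.eval ![K, L, p, 1 / δ, 1 / (p - 2)] P *
            ((n : ℝ) ^ (1 / 2 : ℝ) + (N : ℝ) ^ (1 / p))} := by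
  -- `L + 1` keeps the threshold positive when `L = 0`; `1944 = 18 · 108` comes from
  -- `(108/δ)^(1/(4p)) ≤ 108/δ`, which removes the non-polynomial power.
  refine ⟨.C 4 * .X 0 * (1 + .C 2 * .X 4) + .C 1944 * (.X 1 + 1) * .X 3, ?_⟩
  intro p δ K L hp hδ hK hL n N Ω _ μ _ X hX hind hb
  rcases le_or_gt 1 δ with hδ1 | hδ1
  · exact (by linarith : 1 - δ ≤ 0).trans measureReal_nonneg
  have heval : MvPolynomial.eval ![K, L, p, 1 / δ, 1 / (p - 2)]
      (.C 4 * .X 0 * (1 + .C 2 * .X 4) + .C 1944 * (.X 1 + 1) * .X 3) =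
      4 * K * (1 + 2 * (1 / (p - 2))) + 1944 * (L + 1) * (1 / δ) := by
    simp
  rw [heval]
  set τ := (L + 1) * (108 / δ) ^ (1 / (4 * p)) with hτ
  set good := {ω | ellTwoToEllNorm p (rowMatrix X ω) ≤
    (4 * K * (1 + 2 * (1 / (p - 2))) + 1944 * (L + 1) * (1 / δ)) *
      ((n : ℝ) ^ (1 / 2 : ℝ) + (N : ℝ) ^ (1 / p))} with hgood
  set bad := {ω | ∃ k : ℕ, 1 ≤ k ∧ k ≤ N ∧ ¬ SpreadAt k
    (τ * ((N : ℝ) / k) ^ (1 / (2 * p))) fun i => X i ω}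
  have hp2 : 0 < 1 / (p - 2) := one_div_pos.2 (by linarith)
  have hbadμ : μ bad ≤ ENNReal.ofReal δ :=
    measure_exists_not_spreadAt_le hX hind (by linarith) hδ hδ1.le (by linarith) fun i x hx =>
      (hb.moment i x hx).trans (ENNReal.ofReal_le_ofReal (by linarith))
  have hτle : 18 * τ ≤ 1944 * (L + 1) * (1 / δ) := by
    have h1 : (108 / δ) ^ (1 / (4 * p)) ≤ 108 / δ :=
      rpow_one_div_le_self (by rw [le_div_iff₀ hδ]; linarith) (by linarith)
    calc 18 * τ ≤ 18 * ((L + 1) * (108 / δ)) := by rw [hτ]; gcongr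
      _ = _ := by ring
  have hcover : ∀ᵐ ω ∂μ, ω ∈ good ∪ bad := by
    filter_upwards [ae_all_iff.2 hb.bounded] with ω hω
    by_cases hωbad : ω ∈ bad
    · exact Or.inr hωbad
    left
    have hspread : ∀ k : ℕ, 1 ≤ k → k ≤ N →
        SpreadAt k (τ * ((N : ℝ) / k) ^ (1 / (2 * p))) fun i => X i ω := by
      intro k hk hkN
      by_contra hcon
      exact hωbad ⟨k, hk, hkN, hcon⟩
    rw [hgood, Set.mem_ofPred_eq, ellTwoToEllNorm]
    refine csSup_le (Set.Nonempty.image _ ⟨0, Metric.mem_closedBall_self zero_le_one⟩) ?_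
    rintro _ ⟨x, hx, rfl⟩
    have hrow : (rowMatrix X ω).mulVec x.ofLp = fun i => inner ℝ (X i ω) x := by
      ext i
      simp [rowMatrix, Matrix.mulVec, dotProduct, PiLp.inner_apply, mul_comm]
    simp only [hrow]
    refine (ellNorm_inner_le_of_spreadAt hp (by positivity) (by positivity) hω hspread
      (by simpa using hx)).trans ?_
    rw [← Real.sqrt_eq_rpow]
    have h1 : 0 ≤ 4 * K * (1 + 2 * (1 / (p - 2))) * (N : ℝ) ^ (1 / p) := by positivity
    have h2 : 0 ≤ 1944 * (L + 1) * (1 / δ) * √(n : ℝ) := by positivity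
    have h3 := mul_le_mul_of_nonneg_right hτle
      (by positivity : 0 ≤ (N : ℝ) ^ (1 / p))
    linarith
  -- Only monotonicity and subadditivity enter, so measurability of `good` and `bad` is not needed.
  have h1 : (1 : ENNReal) ≤ μ good + ENNReal.ofReal δ := by
    calc (1 : ENNReal) = μ Set.univ := measure_univ.symm
      _ ≤ μ (good ∪ bad) := measure_mono_ae (by filter_upwards [hcover] with ω h _ using h)
      _ ≤ μ good + μ bad := measure_union_le _ _
      _ ≤ _ := by gcongr
  have h2 := ENNReal.toReal_mono (by finiteness) h1
  rw [ENNReal.toReal_add (measure_ne_top _ _) ENNReal.ofReal_ne_top,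
    ENNReal.toReal_ofReal hδ.le, ENNReal.toReal_one] at h2
  rw [Measure.real]
  linarith
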